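/- A hypothesis class is an arbitrary set $\mathcal H\subseteq\{0,1\}^{\mathbb N}$. A sample of size $m$ is an element $S=((x_1,y_1),\dots,(x_m,y_m))$ of $(\mathbb N\times\{0,1\})^m$, and a learner is a function $A$ from the set of all samples (of all sizes $m\in\mathbb N$) to $\{0,1\}^{\mathbb N}$. For $m\ge 1$ put $L_S(h)=\frac1m\,|\{i: h(x_i)\ne y_i\}|$, and for a probability distribution $D$ on $\mathbb N\times\{0,1\}$ put $L_D(h)=\Pr_{(x,y)\sim D}[h(x)\neq y]$. - $A$ is *computable* if there is an algorithm which, given a sample $S$, outputs a program that computes the function $A(S)$ (halting on every input). $A$ is *proper* for $\mathcal H$ if $A(S)\in\mathcal H$ for every sample $S$. - $A$ *PAC learns* $\mathcal H$ if for every integer $n\ge 1$ there is $m_n$ such that for every $m\ge m_n$ and every probability distribution $D$ on $\mathbb N\times\{0,1\}$, $$\Pr_{S\sim D^m}\Big[L_D(A(S))\le \inf_{h\in\mathcal H}L_D(h)+\tfrac1n\Big]\ge 1-\tfrac1n .$$ - $\mathcal H$ is *properly CPAC learnable* if some computable learner that is proper for $\mathcal H$ PAC learns $\mathcal H$. - $\mathcal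 H$ *shatters* a finite set $X\subset\mathbb N$ if every function $X\to\{0,1\}$ is the restriction to $X$ of some $h\in\mathcal H$. The *VC dimension* of $\mathcal H$ is the supremum in $\mathbb N\cup\{\infty\}$ of the sizes of the finite sets that $\mathcal H$ shatters. - $A$ is an *asymptotic ERM* for $\mathcal H$ if it is proper for $\mathcal H$ and there is a sequence $(\varepsilon_m)_{m\ge1}$ in $[0,1]$ with $\varepsilon_m\to0$ such that $L_S(A(S))\le\inf_{h\in\mathcal H}L_S(h)+\varepsilon_{|S|}$ for every sample $S$ of positive size. **Proposition.** A hypothesis class $\mathcal H\subseteq\{0,1\}^{\mathbb N}$ is properly CPAC learnable if and only if its VC dimension is finite and there is a computable asymptotic ERM for $\mathcal H$. -/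

import Mathlib

open MeasureTheory Filter Topology

namespace CPAC

/-- A sample: a finite sequence of points of `ℕ` labelled by `0` (`false`) or `1` (`true`).
Its size is the length of the list. -/
abbrev Sample : Type := List (ℕ × Bool)

/-- A hypothesis class: an arbitrary subset of `{0,1}^ℕ`. -/
abbrev HypothesisClass : Type := Set (ℕ → Bool)

/-- A learner: an arbitrary function from the set of all samples to `{0,1}^ℕ`. -/
abbrev Learner : Type := Sample → ℕ → Bool

/-- The generalization error `L_D(h) = Pr_{(x,y) ∼ D}[h(x) ≠ y]`. -/
noncomputable def genError (D : Measure (ℕ × Bool)) (h : ℕ → Bool) : ℝ :=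
  D.real {p | h p.1 ≠ p.2}

/-- The error of `h` on a sample: the fraction of the entries `(x, y)` of the sample, counted with
repetitions, with `h(x) ≠ y`. -/
noncomputable def sampleError (S : Sample) (h : ℕ → Bool) : ℝ :=
  (S.countP (fun p => h p.1 ≠ p.2) : ℝ) / (S.length : ℝ)

/-- `A` PAC learns `H` (agnostic setting). A sample `S ∼ D^m` is a point of the product space
`Fin m → ℕ × Bool` with the `m`-fold product measure. The infimum is that of a nonempty set of
reals bounded below by `0` as soon as `H` is nonempty, in particular when some learner is
proper for `H`. -/
def PACLearns (A : Learner) (H : HypothesisClass) : Prop :=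
  ∀ n : ℕ, 1 ≤ n → ∃ mₙ : ℕ, ∀ m : ℕ, mₙ ≤ m →
    ∀ D : Measure (ℕ × Bool), IsProbabilityMeasure D →
      1 - 1 / (n : ℝ) ≤
        (Measure.pi (fun _ : Fin m => D)).real
          {S | genError D (A (List.ofFn S)) ≤ (⨅ h : H, genError D h) + 1 / (n : ℝ)}

/-- `A` is proper for `H`: it only outputs hypotheses from `H`. -/
def IsProper (A : Learner) (H : HypothesisClass) : Prop :=
  ∀ S : Sample, A S ∈ H

/-- A learner is computable if some algorithm transforms every sample `S` into (the code of) a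
program which, on every input `x`, halts with output `A(S)(x)`. -/
def IsComputableLearner (A : Learner) : Prop :=
  ∃ c : Sample → Nat.Partrec.Code, Computable c ∧
    ∀ (S : Sample) (x : ℕ), (c S).eval x = Part.some (A S x).toNat

/-- `H` is properly CPAC learnable: some computable learner that is proper for `H` PAC learns
`H`. -/
def ProperlyCPACLearnable (H : HypothesisClass) : Prop :=
  ∃ A : Learner, IsComputableLearner A ∧ IsProper A H ∧ PACLearns A H

/-- `H` shatters the finite set `X` of natural numbers: every labelling of `X` is realized by a
member of `H`. -/
def Shatters (H : HypothesisClass) (X : Finset ℕ) : Prop :=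
  ∀ f : X → Bool, ∃ h ∈ H, ∀ x : X, h x = f x

/-- The VC dimension: the largest size of a shattered set, `⊤` if these sizes are unbounded. -/
noncomputable def vcDim (H : HypothesisClass) : ℕ∞ :=
  ⨆ (X : Finset ℕ) (_ : Shatters H X), (X.card : ℕ∞)

/-- `A` is an asymptotic ERM for `H`. The value `ε 0` plays no role, since the error on a sample is
only defined for samples of positive size. -/
def IsAsymptoticERM (A : Learner) (H : HypothesisClass) : Prop :=
  IsProper A H ∧
    ∃ ε : ℕ → ℝ, (∀ m, ε m ∈ Set.Icc (0 : ℝ) 1) ∧ Tendsto ε atTop (𝓝 0) ∧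
      ∀ S : Sample, S ≠ [] →
        sampleError S (A S) ≤ (⨅ h : H, sampleError S h) + ε S.length

end CPAC

/-! From PAC learning to an asymptotic ERM: for the uniform distribution on the entries of a sample
`S`, the generalization error is `L_S`, so the PAC guarantee makes some training sequence drawn from
`S` yield a near-minimiser of `L_S`. Such sequences of length `|S|` are finitely many, so exhaustive
search (`bestWord`) finds a best one computably, and the output stays in `H`. Finite VC dimension is
the no-free-lunch argument (`le_two_mul_sum_trainedErrors`): on a shattered set of more than twice
the sample size, the learner guesses blindly on over half of the points.

Conversely, finite VC dimension gives uniform convergence at a rate independent of `D`: a ghost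
sample, Sauer–Shelah and Massart's lemma bound the expected `deviation`, and Markov's inequality
turns this into a probability. A nearly optimal sample error then forces a nearly optimal
generalization error. The learner itself is unchanged. -/

/-! ### Computability of the exhaustive search -/

theorem Computable.list_foldl {α β σ : Type*} [Primcodable α] [Primcodable β] [Primcodable σ]
    {f : α → List β} {g : α → σ} {h : α → σ × β → σ}
    (hf : Computable f) (hg : Computable g) (hh : Computable₂ h) :
    Computable fun a => (f a).foldl (fun s b => h a (s, b)) (g a) := by
  have hstep : Computable₂ fun (a : α) (p : ℕ × σ) =>
      ((f a)[p.1]?.casesOn p.2 (fun b => h a (p.2, b)) : σ) := by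
    refine Computable.option_casesOn (o := fun q : α × ℕ × σ => (f q.1)[q.2.1]?)
      (f := fun q => q.2.2) (g := fun q b => h q.1 (q.2.2, b)) ?_ ?_ ?_
    · exact Computable.list_getElem?.comp (hf.comp .fst) (Computable.fst.comp .snd)
    · exact Computable.snd.comp .snd
    · exact hh.comp (Computable.fst.comp .fst)
        (Computable.pair (Computable.snd.comp (Computable.snd.comp .fst)) .snd)
  refine (Computable.nat_rec (Computable.list_length.comp hf) hg hstep).of_eq fun a => ?_
  -- Up to the length every index is in range, so the `none` branch is never taken.
  have key : ∀ n ≤ (f a).length,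
      (Nat.rec (g a) (fun i s => ((f a)[i]?.casesOn s (fun b => h a (s, b)) : σ)) n : σ) =
        ((f a).take n).foldl (fun s b => h a (s, b)) (g a) := by
    intro n
    induction n with
    | zero => simp
    | succ k ih =>
      intro hk
      have hk' : k < (f a).length := hk
      rw [List.take_add_one, List.foldl_append, ← ih hk'.le]
      simp [List.getElem?_eq_getElem hk']
  have := key _ le_rfl
  rw [List.take_length] at this
  exact this

theorem List.foldl_argmin_le {β : Type*} (e : β → ℕ) (l : List β) (s : β) :
    e (l.foldl (fun s b => if e b < e s then b else s) s) ≤ e s ∧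
      ∀ b ∈ l, e (l.foldl (fun s b => if e b < e s then b else s) s) ≤ e b := by
  induction l generalizing s with
  | nil => simp
  | cons a l ih =>
    obtain ⟨h1, h2⟩ := ih (if e a < e s then a else s)
    simp only [List.foldl_cons, List.mem_cons, forall_eq_or_imp]
    have h3 : e (if e a < e s then a else s) ≤ e s ∧ e (if e a < e s then a else s) ≤ e a := by
      split_ifs <;> omega
    exact ⟨h1.trans h3.1, h1.trans h3.2, h2⟩

theorem List.countP_eq_foldl {β : Type*} (p : β → Bool) (l : List β) :
    l.countP p = l.foldl (fun n b => if p b then n + 1 else n) 0 := by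
  suffices h : ∀ n, l.foldl (fun n b => if p b then n + 1 else n) n = n + l.countP p by
    simp [h 0]
  induction l with
  | nil => simp
  | cons a l ih => intro n; simp only [List.foldl_cons, ih, List.countP_cons]; split_ifs <;> omega

namespace CPAC

/-- All lists of length `k` with entries from `S`. -/
def words {α : Type*} (S : List α) (k : ℕ) : List (List α) :=
  Nat.rec [[]] (fun _ C => C.flatMap fun T => S.map fun p => p :: T) k

theorem mem_words {α : Type*} {S : List α} {k : ℕ} {T : List α} :
    T ∈ words S k ↔ T.length = k ∧ ∀ p ∈ T, p ∈ S := by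
  induction k generalizing T with
  | zero => simp +contextual [words, List.length_eq_zero_iff]
  | succ k ih =>
    change T ∈ ((words S k).flatMap fun T => S.map fun p => p :: T) ↔ _
    simp only [List.mem_flatMap, List.mem_map, ih]
    cases T with
    | nil => simp
    | cons a T => simp; tauto

theorem primrec_words {α : Type*} [Primcodable α] : Primrec₂ (words (α := α)) := by
  refine Primrec.nat_rec (f := fun _ : List α => [[]])
    (g := fun S p => p.2.flatMap fun T => S.map fun q => q :: T) (.const _) ?_
  refine Primrec.list_flatMap (Primrec.snd.comp .snd) ?_
  refine Primrec.list_map (Primrec.fst.comp .fst) ?_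
  exact Primrec.list_cons.comp .snd (Primrec.snd.comp .fst)

theorem IsComputableLearner.computable₂ {A : Learner} (hA : IsComputableLearner A) :
    Computable₂ A := by
  obtain ⟨c, hc, hA⟩ := hA
  have h1 : Partrec fun q : Sample × ℕ => (c q.1).eval q.2 :=
    Nat.Partrec.Code.eval_part.comp (hc.comp .fst) .snd
  have h2 : Computable fun q : Sample × ℕ => (A q.1 q.2).toNat :=
    h1.of_eq fun q => hA q.1 q.2
  have h3 : Computable fun n : ℕ => decide (n = 1) :=
    (Primrec.eq.comp .id (.const 1)).decide.to_comp
  refine (h3.comp h2).of_eq fun q => ?_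
  cases A q.1 q.2 <;> simp

/-- The number of entries of `S` on which `h` errs. -/
def errorCount (S : Sample) (h : ℕ → Bool) : ℕ := S.countP fun p => h p.1 ≠ p.2

theorem computable_errorCount {A : Learner} (hA : Computable₂ A) :
    Computable₂ fun S T : Sample => errorCount S (A T) := by
  have h := Computable.list_foldl (f := fun q : Sample × Sample => q.1) (g := fun _ => 0)
    (h := fun q r => bif (A q.2 r.2.1).xor r.2.2 then r.1 + 1 else r.1) .fst (.const 0) (by
      refine Computable.cond ?_ ?_ ?_
      · exact (Primrec.dom_bool₂ Bool.xor).to_comp.comp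
          (hA.comp (Computable.snd.comp .fst)
            (Computable.fst.comp (Computable.snd.comp .snd)))
          (Computable.snd.comp (Computable.snd.comp .snd))
      · exact Computable.succ.comp (Computable.fst.comp .snd)
      · exact Computable.fst.comp .snd)
  refine h.of_eq fun q => ?_
  simp only [errorCount, List.countP_eq_foldl]
  congr! 4 with n b
  cases A q.2 b.1 <;> cases b.2 <;> rfl

/-- A list `T` with entries from `S`, of the same length as `S` unless it is empty, for which the
hypothesis `A T` errs least often on `S`. -/
def bestWord (A : Learner) (S : Sample) : Sample :=
  (words S S.length).foldl
    (fun s b => if errorCount S (A b) < errorCount S (A s) then b else s) []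

theorem errorCount_bestWord_le (A : Learner) {S T : Sample} (hT : T ∈ words S S.length) :
    errorCount S (A (bestWord A S)) ≤ errorCount S (A T) :=
  (List.foldl_argmin_le (fun T => errorCount S (A T)) _ _).2 T hT

theorem computable_bestWord {A : Learner} (hA : Computable₂ A) : Computable (bestWord A) := by
  have he := computable_errorCount hA
  have h := Computable.list_foldl (f := fun S : Sample => words S S.length)
    (g := fun _ => ([] : Sample))
    (h := fun S r => bif decide (errorCount S (A r.2) < errorCount S (A r.1)) then r.2 else r.1)
    (primrec_words.to_comp.comp .id Computable.list_length) (.const _) (by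
      refine Computable.cond ?_ (Computable.snd.comp .snd) (Computable.fst.comp .snd)
      have hlt : Computable₂ fun a b : ℕ => decide (a < b) := Primrec.nat_lt.decide.to_comp
      exact hlt.comp (he.comp .fst (Computable.snd.comp .snd))
        (he.comp .fst (Computable.fst.comp .snd)))
  refine h.of_eq fun S => ?_
  simp only [bestWord, Bool.cond_decide]

/-- Only the choice of the training word requires running `A`, which always halts; the program
output is the old one for that word. -/
theorem IsComputableLearner.bestWord {A : Learner} (hA : IsComputableLearner A) :
    IsComputableLearner fun S => A (CPAC.bestWord A S) := by
  have h := computable_bestWord hA.computable₂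
  obtain ⟨c, hc, hA⟩ := hA
  exact ⟨fun S => c (CPAC.bestWord A S), hc.comp h, fun S x => hA _ x⟩

end CPAC

/-! ### Empirical distributions and the asymptotic ERM -/

open ProbabilityTheory in
theorem ProbabilityTheory.uniformOn_univ_real {Ω : Type*} [MeasurableSpace Ω]
    [MeasurableSingletonClass Ω] [Fintype Ω] (s : Set Ω) [DecidablePred (· ∈ s)] :
    (uniformOn (Set.univ : Set Ω)).real s =
      (Finset.univ.filter (· ∈ s)).card / (Fintype.card Ω : ℝ) := by
  have hs : s = ((Finset.univ.filter (· ∈ s) : Finset Ω) : Set Ω) := by ext; simp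
  rw [Measure.real, uniformOn_univ]
  conv_lhs => rw [hs, Measure.count_apply_finset]
  simp

namespace CPAC

open ProbabilityTheory

/-- The law of a uniformly chosen entry of a finite tuple. -/
noncomputable def empirical {k : ℕ} (φ : Fin k → ℕ × Bool) : Measure (ℕ × Bool) :=
  (uniformOn (Set.univ : Set (Fin k))).map φ

instance {k : ℕ} [NeZero k] (φ : Fin k → ℕ × Bool) : IsProbabilityMeasure (empirical φ) := by
  have := isProbabilityMeasure_uniformOn (Set.finite_univ (α := Fin k)) Set.univ_nonempty
  exact Measure.isProbabilityMeasure_map (measurable_of_finite φ).aemeasurable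

theorem genError_empirical {k : ℕ} (φ : Fin k → ℕ × Bool) (h : ℕ → Bool) :
    genError (empirical φ) h =
      (Finset.univ.filter fun i => h (φ i).1 ≠ (φ i).2).card / (k : ℝ) := by
  classical
  rw [genError, empirical, map_measureReal_apply (measurable_of_finite φ)
    (Set.to_countable _).measurableSet, uniformOn_univ_real]
  simp

-- Independent draws of entries amount to a uniform tuple of indices, so probabilities become
-- counts.
open scoped Classical in
theorem pi_empirical_real {k m : ℕ} [NeZero k] (φ : Fin k → ℕ × Bool)
    (E : Set (Fin m → ℕ × Bool)) :
    (Measure.pi fun _ : Fin m => empirical φ).real E =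
      (Finset.univ.filter fun g : Fin m → Fin k => φ ∘ g ∈ E).card / (k : ℝ) ^ m := by
  have hφ := measurable_of_finite φ
  have h1 : (Measure.pi fun _ : Fin m => empirical φ) =
      (uniformOn (Set.univ : Set (Fin m → Fin k))).map fun g => φ ∘ g := by
    rw [← Set.pi_univ Set.univ, uniformOn_pi]
    have : SigmaFinite ((uniformOn (Set.univ : Set (Fin k))).map φ) :=
      inferInstanceAs (SigmaFinite (empirical φ))
    exact (Measure.pi_map_pi (ι := Fin m) (f := fun _ => φ) fun _ => hφ.aemeasurable).symm
  rw [h1, map_measureReal_apply (measurable_of_finite _) (Set.to_countable _).measurableSet,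
    uniformOn_univ_real]
  simp

theorem sampleError_eq (S : Sample) (h : ℕ → Bool) :
    sampleError S h = errorCount S h / S.length := rfl

theorem errorCount_ofFn {m : ℕ} (φ : Fin m → ℕ × Bool) (h : ℕ → Bool) :
    errorCount (List.ofFn φ) h = (Finset.univ.filter fun i => h (φ i).1 ≠ (φ i).2).card := by
  induction m with
  | zero => simp [errorCount]
  | succ m ih =>
    rw [Fin.card_filter_univ_succ, ← ih fun i => φ i.succ]
    simp only [errorCount, List.ofFn_succ, List.countP_cons, decide_eq_true_eq]
    split_ifs <;> rfl

theorem genError_empirical_get (S : Sample) (h : ℕ → Bool) :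
    genError (empirical S.get) h = sampleError S h := by
  rw [genError_empirical, sampleError_eq, ← errorCount_ofFn, List.ofFn_get]

theorem sampleError_mem_Icc (S : Sample) (h : ℕ → Bool) : sampleError S h ∈ Set.Icc (0 : ℝ) 1 := by
  refine ⟨by unfold sampleError; positivity, div_le_one_of_le₀ ?_ (by positivity)⟩
  exact_mod_cast List.countP_le_length

theorem bddBelow_sampleError (S : Sample) (H : HypothesisClass) :
    BddBelow (Set.range fun h : H => sampleError S h) :=
  ⟨0, by rintro _ ⟨h, rfl⟩; exact (sampleError_mem_Icc S h).1⟩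

/-- The success event has probability at least `1 - 1/n > 0`, as `2 ≤ n`, so it contains a draw of
entries of `S`. Since `m = |S|`, that draw is among the words searched. -/
theorem sampleError_bestWord_le {A : Learner} {H : HypothesisClass} {n m : ℕ} (hn : 2 ≤ n)
    (hm : ∀ D : Measure (ℕ × Bool), IsProbabilityMeasure D →
      1 - 1 / (n : ℝ) ≤ (Measure.pi (fun _ : Fin m => D)).real
        {S | genError D (A (List.ofFn S)) ≤ (⨅ h : H, genError D h) + 1 / (n : ℝ)})
    {S : Sample} (hS : S ≠ []) (hl : S.length = m) :
    sampleError S (A (bestWord A S)) ≤ (⨅ h : H, sampleError S h) + 1 / (n : ℝ) := by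
  classical
  have : NeZero S.length := ⟨by simpa using hS⟩
  have h1 := hm (empirical S.get) inferInstance
  rw [pi_empirical_real] at h1
  have hn' : (2 : ℝ) ≤ n := by exact_mod_cast hn
  have h2 : (0 : ℝ) < 1 - 1 / n := by
    rw [sub_pos, div_lt_one (by linarith)]; linarith
  obtain ⟨g, hg⟩ : (Finset.univ.filter fun g : Fin m → Fin S.length => S.get ∘ g ∈
      {T | genError (empirical S.get) (A (List.ofFn T)) ≤
        (⨅ h : H, genError (empirical S.get) h) + 1 / (n : ℝ)}).Nonempty := by
    rw [Finset.nonempty_iff_ne_empty]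
    intro h0
    rw [h0] at h1
    simp only [Finset.card_empty, Nat.cast_zero, zero_div] at h1
    linarith
  simp only [genError_empirical_get, Finset.mem_filter, Set.mem_ofPred_eq] at hg
  refine le_trans ?_ hg.2
  rw [sampleError_eq, sampleError_eq]
  gcongr
  apply errorCount_bestWord_le
  rw [mem_words]
  refine ⟨by simp [hl], ?_⟩
  simp only [List.mem_ofFn]
  rintro _ ⟨i, rfl⟩
  exact List.get_mem _ _

theorem PACLearns.isAsymptoticERM_bestWord {A : Learner} {H : HypothesisClass}
    (hp : IsProper A H) (hA : PACLearns A H) :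
    IsAsymptoticERM (fun S => A (bestWord A S)) H := by
  refine ⟨fun S => hp _, ?_⟩
  set e : Sample → ℝ := fun S => sampleError S (A (bestWord A S)) - ⨅ h : H, sampleError S h
    with he
  have : Nonempty H := ⟨⟨A [], hp _⟩⟩
  have he0 : ∀ S, 0 ≤ e S := fun S =>
    sub_nonneg.2 (ciInf_le (bddBelow_sampleError S H) ⟨_, hp (bestWord A S)⟩)
  have he1 : ∀ S, e S ≤ 1 := fun S => by
    have h1 := (sampleError_mem_Icc S (A (bestWord A S))).2
    have h2 : 0 ≤ ⨅ h : H, sampleError S h :=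
      le_ciInf fun h => (sampleError_mem_Icc S h).1
    simp only [he]; linarith
  have hbdd : ∀ m, BddAbove (e '' {S | S.length = m}) := fun m =>
    ⟨1, by rintro _ ⟨S, -, rfl⟩; exact he1 S⟩
  have hne : ∀ m, (e '' {S | S.length = m}).Nonempty := fun m =>
    ⟨_, List.replicate m (0, true), by simp, rfl⟩
  have hε0 : ∀ m, 0 ≤ sSup (e '' {S | S.length = m}) := fun m =>
    Real.sSup_nonneg (by rintro _ ⟨S, -, rfl⟩; exact he0 S)
  -- `ε m` is the worst excess over all samples of size `m`; it tends to `0` because the PAC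
  -- threshold is uniform in `D`.
  refine ⟨fun m => sSup (e '' {S | S.length = m}), fun m => ⟨hε0 m, ?_⟩, ?_, fun S _ => ?_⟩
  · exact csSup_le (hne m) (by rintro _ ⟨S, -, rfl⟩; exact he1 S)
  · rw [Metric.tendsto_atTop]
    intro δ hδ
    obtain ⟨n, hn⟩ := exists_nat_one_div_lt hδ
    -- The shift by two secures both `2 ≤ n + 2` and `1/(n+2) ≤ 1/(n+1) < δ`.
    obtain ⟨N, hN⟩ := hA (n + 2) (by omega)
    refine ⟨N + 1, fun m hm => ?_⟩
    rw [Real.dist_eq, sub_zero, abs_of_nonneg (hε0 m)]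
    refine lt_of_le_of_lt (csSup_le (hne m) ?_) hn
    rintro _ ⟨S, hS, rfl⟩
    have hS' : S.length = m := hS
    have h1 := sampleError_bestWord_le (by omega) (hN m (by omega)) (S := S)
      (by rintro rfl; simp at hS'; omega) hS
    have h2 : 1 / ((n + 2 : ℕ) : ℝ) ≤ 1 / (n + 1 : ℝ) := by
      push_cast; gcongr; norm_num
    simp only [he]; linarith
  · have := le_csSup (hbdd S.length) ⟨S, rfl, rfl⟩
    simp only [he] at this ⊢; linarith

end CPAC

/-! ### No free lunch: PAC learning forces finite VC dimension -/

namespace CPAC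

/-- The number of points of the domain `e` on which `A`, trained on the points `e ∘ g` labelled by
`f`, disagrees with `f`. -/
def trainedErrors (A : Learner) {k m : ℕ} (e : Fin k → ℕ) (f : Fin k → Bool)
    (g : Fin m → Fin k) : ℕ :=
  (Finset.univ.filter fun i => A (List.ofFn fun j => (e (g j), f (g j))) (e i) ≠ f i).card

/-- Flipping `f` at a point outside the range of `g` leaves the training sample unchanged, so
exactly one of the two labellings produces an error there. At least `k - m` points are unseen. -/
theorem le_two_mul_sum_trainedErrors (A : Learner) {k m : ℕ} (e : Fin k → ℕ)
    (g : Fin m → Fin k) : (k - m) * 2 ^ k ≤ 2 * ∑ f, trainedErrors A e f g := by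
  classical
  have hflip : ∀ i, i ∉ Finset.univ.image g →
      2 * ∑ f : Fin k → Bool,
        (if A (List.ofFn fun j => (e (g j), f (g j))) (e i) ≠ f i then 1 else 0) = 2 ^ k := by
    intro i hi
    have hinv : Function.Involutive fun f : Fin k → Bool => Function.update f i (!f i) := by
      intro f; ext j; by_cases h : j = i
      · subst h; simp
      · simp [h]
    rw [two_mul]
    conv_lhs => arg 2; rw [← Equiv.sum_comp hinv.toPerm]
    rw [← Finset.sum_add_distrib, Finset.sum_congr rfl (g := fun _ => 1)]
    · simp
    intro f _
    have hg : ∀ j, g j ≠ i := fun j hj => hi (Finset.mem_image.2 ⟨j, Finset.mem_univ _, hj⟩)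
    simp only [Function.Involutive.coe_toPerm, Function.update_of_ne (hg _),
      Function.update_self]
    cases A (List.ofFn fun j => (e (g j), f (g j))) (e i) <;> cases f i <;> rfl
  have hcard : k - m ≤ (Finset.univ \ Finset.univ.image g).card := by
    have h := Finset.le_card_sdiff (Finset.univ.image g) Finset.univ
    have h2 := Finset.card_image_le (s := Finset.univ) (f := g)
    simp only [Finset.card_univ, Fintype.card_fin] at h h2
    omega
  calc (k - m) * 2 ^ k
      ≤ ∑ i ∈ Finset.univ \ Finset.univ.image g, 2 ^ k := by
        rw [Finset.sum_const, smul_eq_mul]; gcongr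
    _ = ∑ i ∈ Finset.univ \ Finset.univ.image g, 2 * ∑ f : Fin k → Bool,
        (if A (List.ofFn fun j => (e (g j), f (g j))) (e i) ≠ f i then 1 else 0) :=
        Finset.sum_congr rfl fun i hi => (hflip i (Finset.mem_sdiff.1 hi).2).symm
    _ ≤ ∑ i, 2 * ∑ f : Fin k → Bool,
        (if A (List.ofFn fun j => (e (g j), f (g j))) (e i) ≠ f i then 1 else 0) :=
        Finset.sum_le_sum_of_subset (Finset.sdiff_subset)
    _ = 2 * ∑ f, trainedErrors A e f g := by
        rw [← Finset.mul_sum, Finset.sum_comm]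
        simp only [trainedErrors, Finset.card_filter]

/-- Realizability makes the infimum zero. Good draws cost at most `k/9`; the others, at most a ninth
of all draws, cost at most `k`. -/
theorem sum_trainedErrors_le {A : Learner} {H : HypothesisClass} {k m : ℕ} [NeZero k]
    (hm : ∀ D : Measure (ℕ × Bool), IsProbabilityMeasure D →
      1 - 1 / ((9 : ℕ) : ℝ) ≤ (Measure.pi (fun _ : Fin m => D)).real
        {S | genError D (A (List.ofFn S)) ≤ (⨅ h : H, genError D h) + 1 / ((9 : ℕ) : ℝ)})
    (e : Fin k → ℕ) (f : Fin k → Bool) (hf : ∃ h ∈ H, ∀ i, h (e i) = f i) :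
    (∑ g : Fin m → Fin k, (trainedErrors A e f g : ℝ)) ≤ 2 / 9 * k * k ^ m := by
  classical
  have hk : (0 : ℝ) < k := by exact_mod_cast Nat.pos_of_ne_zero (NeZero.ne k)
  set φ : Fin k → ℕ × Bool := fun i => (e i, f i) with hφ
  have h1 := hm (empirical φ) inferInstance
  rw [pi_empirical_real, le_div_iff₀ (by positivity)] at h1
  set E : Set (Fin m → ℕ × Bool) := {S | genError (empirical φ) (A (List.ofFn S)) ≤
    (⨅ h : H, genError (empirical φ) h) + 1 / ((9 : ℕ) : ℝ)} with hE
  set G := Finset.univ.filter fun g : Fin m → Fin k => φ ∘ g ∈ E with hG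
  have hinf : (⨅ h : H, genError (empirical φ) h) ≤ 0 := by
    obtain ⟨h, hh, hhf⟩ := hf
    refine (ciInf_le ⟨0, ?_⟩ ⟨h, hh⟩).trans ?_
    · rintro _ ⟨h, rfl⟩; exact measureReal_nonneg
    · simp [genError_empirical, hφ, hhf]
  have hgood : ∀ g ∈ G, (trainedErrors A e f g : ℝ) ≤ k / 9 := by
    intro g hg
    have h2 : genError (empirical φ) (A (List.ofFn (φ ∘ g))) ≤ _ := (Finset.mem_filter.1 hg).2
    rw [genError_empirical] at h2
    have h3 : (trainedErrors A e f g : ℝ) / k ≤ 1 / 9 := by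
      refine le_trans (le_of_eq ?_) (h2.trans ?_)
      · rfl
      · push_cast; linarith
    rw [div_le_iff₀ hk] at h3
    linarith
  have hall : ∀ g : Fin m → Fin k, (trainedErrors A e f g : ℝ) ≤ k := by
    intro g
    have h := Finset.card_filter_le (Finset.univ : Finset (Fin k))
      fun i => A (List.ofFn fun j => (e (g j), f (g j))) (e i) ≠ f i
    rw [Finset.card_univ, Fintype.card_fin] at h
    exact_mod_cast h
  have hcard : ((Finset.univ : Finset (Fin m → Fin k)).card : ℝ) = k ^ m := by simp
  have hcompl : ((Finset.univ.filter fun g : Fin m → Fin k => ¬ φ ∘ g ∈ E).card : ℝ) =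
      k ^ m - G.card := by
    have h := Finset.card_filter_add_card_filter_not (s := (Finset.univ : Finset (Fin m → Fin k)))
      (fun g : Fin m → Fin k => φ ∘ g ∈ E)
    rw [← hcard, ← h]
    push_cast
    exact (add_sub_cancel_left _ _).symm
  have hGle : (G.card : ℝ) ≤ k ^ m := by
    rw [← hcard]; exact_mod_cast Finset.card_filter_le _ _
  rw [← Finset.sum_filter_add_sum_filter_not _ (fun g : Fin m → Fin k => φ ∘ g ∈ E)]
  have h4 := Finset.sum_le_card_nsmul G _ _ hgood
  have h5 := Finset.sum_le_card_nsmul (Finset.univ.filter fun g : Fin m → Fin k => ¬ φ ∘ g ∈ E)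
    (fun g => (trainedErrors A e f g : ℝ)) _ fun g _ => hall g
  rw [nsmul_eq_mul] at h4 h5
  rw [hcompl] at h5
  push_cast at h1
  nlinarith

theorem PACLearns.vcDim_lt_top {A : Learner} {H : HypothesisClass} (hA : PACLearns A H) :
    vcDim H < ⊤ := by
  by_contra hH
  rw [not_lt_top_iff] at hH
  -- Accuracy `1/9` gives `k - m ≤ 2 * (2/9) * k`, which contradicts `k - m > k/2`.
  obtain ⟨m, hm⟩ := hA 9 (by norm_num)
  have hm := hm m le_rfl
  obtain ⟨X, hX, hmX⟩ : ∃ X, Shatters H X ∧ 2 * m < X.card := by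
    have h : ((2 * m : ℕ) : ℕ∞) < vcDim H := hH ▸ ENat.natCast_lt_top _
    simp only [vcDim, lt_iSup_iff] at h
    obtain ⟨X, hX, h⟩ := h
    exact ⟨X, hX, by exact_mod_cast h⟩
  set k := X.card
  have : NeZero k := ⟨by omega⟩
  set e : Fin k → ℕ := fun i => X.equivFin.symm i with he
  have hreal : ∀ f : Fin k → Bool, ∃ h ∈ H, ∀ i, h (e i) = f i := by
    intro f
    obtain ⟨h, hh, hf⟩ := hX fun x => f (X.equivFin x)
    exact ⟨h, hh, fun i => by rw [he, hf]; simp⟩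
  have hup : ∑ f : Fin k → Bool, ∑ g : Fin m → Fin k, (trainedErrors A e f g : ℝ) ≤
      2 ^ k * (2 / 9 * k * k ^ m) := by
    refine (Finset.sum_le_card_nsmul _ _ _
      fun f _ => sum_trainedErrors_le hm e f (hreal f)).trans_eq ?_
    simp
  have hlow : (k ^ m : ℝ) * ((k - m) * 2 ^ k) ≤
      2 * ∑ f : Fin k → Bool, ∑ g : Fin m → Fin k, (trainedErrors A e f g : ℝ) := by
    rw [Finset.sum_comm, Finset.mul_sum]
    refine le_trans (le_of_eq ?_) (Finset.card_nsmul_le_sum Finset.univ _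
      (((k : ℝ) - m) * 2 ^ k) fun g _ => ?_)
    · simp
    · have h := le_two_mul_sum_trainedErrors A e g
      rw [← Nat.cast_le (α := ℝ)] at h
      push_cast [Nat.cast_sub (show m ≤ k by omega)] at h
      exact h
  have hk : (2 * m : ℝ) < k := by exact_mod_cast hmX
  have hk0 : (0 : ℝ) < k := by linarith [Nat.cast_nonneg (α := ℝ) m]
  have hpos : (0 : ℝ) < k ^ m * 2 ^ k := by positivity
  have : (k ^ m * 2 ^ k : ℝ) * (k - m) ≤ (k ^ m * 2 ^ k) * (4 / 9 * k) := by nlinarith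
  have := le_of_mul_le_mul_left this hpos
  linarith

end CPAC

/-! ### Sauer–Shelah and Massart bounds -/

namespace CPAC

/-- The set of indices on which `h` errs. -/
def errorSet {ι : Type*} [Fintype ι] (z : ι → ℕ × Bool) (h : ℕ → Bool) : Finset ι :=
  Finset.univ.filter fun i => h (z i).1 ≠ (z i).2

theorem mem_errorSet {ι : Type*} [Fintype ι] {z : ι → ℕ × Bool} {h : ℕ → Bool} {i : ι} :
    i ∈ errorSet z h ↔ h (z i).1 ≠ (z i).2 := by
  simp [errorSet]

open scoped Classical in
/-- The error patterns that hypotheses in `H` produce on `z`. -/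
noncomputable def patterns {ι : Type*} [Fintype ι] (H : HypothesisClass) (z : ι → ℕ × Bool) :
    Finset (Finset ι) :=
  Finset.univ.filter fun P => ∃ h ∈ H, errorSet z h = P

theorem card_le_of_vcDim_le {H : HypothesisClass} {d : ℕ} (hd : vcDim H ≤ d) {X : Finset ℕ}
    (hX : Shatters H X) : X.card ≤ d := by
  have h : (X.card : ℕ∞) ≤ vcDim H := le_iSup₂_of_le X hX le_rfl
  exact_mod_cast h.trans hd

-- Error patterns are labellings XORed with the fixed labels of `z`, so all labellings of `T` occur.
-- Hence the points indexed by `T` are distinct and form a shattered set.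
open scoped Classical in
theorem card_le_of_shatters_patterns {ι : Type*} [Fintype ι] {H : HypothesisClass} {d : ℕ}
    (hd : vcDim H ≤ d) {z : ι → ℕ × Bool} {T : Finset ι} (hT : (patterns H z).Shatters T) :
    T.card ≤ d := by
  have key : ∀ u : ι → Bool, ∃ h ∈ H, ∀ i ∈ T, h (z i).1 = u i := by
    intro u
    obtain ⟨P, hP, hTP⟩ := hT (Finset.filter_subset (fun i => u i ≠ (z i).2) T)
    obtain ⟨h, hh, rfl⟩ := (Finset.mem_filter.1 hP).2
    refine ⟨h, hh, fun i hi => ?_⟩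
    have := Finset.ext_iff.1 hTP i
    simp only [Finset.mem_inter, mem_errorSet, Finset.mem_filter, hi, true_and] at this
    revert this
    cases h (z i).1 <;> cases u i <;> cases (z i).2 <;> simp
  have hinj : Set.InjOn (fun i => (z i).1) T := by
    intro i hi j hj hij
    obtain ⟨h, -, hu⟩ := key fun l => decide (l = i)
    have h1 := hu i hi
    have h2 := hu j hj
    simp only at hij
    rw [hij, h2] at h1
    exact (by simpa using h1 : j = i).symm
  rw [← Finset.card_image_of_injOn hinj]
  refine card_le_of_vcDim_le hd fun f => ?_
  obtain ⟨h, hh, hu⟩ := key fun i =>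
    if hi : (z i).1 ∈ T.image fun i => (z i).1 then f ⟨_, hi⟩ else false
  refine ⟨h, hh, ?_⟩
  rintro ⟨x, hx⟩
  obtain ⟨i, hi, rfl⟩ := Finset.mem_image.1 hx
  simpa [hi] using (hu i hi).trans (dif_pos hx)

/-- Each such set is the range of a map from `Fin d`, padded with `none`. -/
theorem card_filter_card_le (ι : Type*) [Fintype ι] [DecidableEq ι] (d : ℕ) :
    (Finset.univ.filter fun T : Finset ι => T.card ≤ d).card ≤ (Fintype.card ι + 1) ^ d := by
  have h : (Finset.univ.filter fun T : Finset ι => T.card ≤ d) ⊆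
      Finset.univ.image fun g : Fin d → Option ι =>
        Finset.univ.filter fun i => some i ∈ Set.range g := by
    intro T hT
    have hT : T.card ≤ d := (Finset.mem_filter.1 hT).2
    refine Finset.mem_image.2 ⟨fun j => if hj : (j : ℕ) < T.card then
      some (T.equivFin.symm ⟨j, hj⟩ : ι) else none, Finset.mem_univ _, ?_⟩
    ext i
    simp only [Finset.mem_filter, Finset.mem_univ, true_and, Set.mem_range]
    constructor
    · rintro ⟨j, hj⟩
      split_ifs at hj with h
      rw [← Option.some.inj hj]
      exact Subtype.prop _
    · intro hi
      refine ⟨⟨T.equivFin ⟨i, hi⟩, (Fin.is_lt _).trans_le hT⟩, ?_⟩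
      simp
  refine (Finset.card_le_card h).trans (Finset.card_image_le.trans_eq ?_)
  simp

/-- Sauer–Shelah in Pajor's form: a family has at most as many members as sets it shatters. -/
theorem card_patterns_le {ι : Type*} [Fintype ι] {H : HypothesisClass} {d : ℕ}
    (hd : vcDim H ≤ d) (z : ι → ℕ × Bool) :
    (patterns H z).card ≤ (Fintype.card ι + 1) ^ d := by
  classical
  refine ((patterns H z).card_le_card_shatterer.trans (Finset.card_le_card ?_)).trans
    (card_filter_card_le ι d)
  intro T hT
  exact Finset.mem_filter.2
    ⟨Finset.mem_univ _, card_le_of_shatters_patterns hd (Finset.mem_shatterer.1 hT)⟩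

/-- The sign `±1` of a Boolean. -/
def sgn (b : Bool) : ℝ := if b then 1 else -1

/-- The sum factors over coordinates into terms `2 cosh (l * v i)`. -/
theorem sum_exp_sgn_le {m : ℕ} (v : Fin m → ℝ) (hv : ∀ i, |v i| ≤ 1) (l : ℝ) :
    ∑ σ : Fin m → Bool, Real.exp (l * ∑ i, sgn (σ i) * v i) ≤
      2 ^ m * Real.exp (m * (l ^ 2 / 2)) := by
  have h1 : ∑ σ : Fin m → Bool, Real.exp (l * ∑ i, sgn (σ i) * v i) =
      ∏ i, ∑ b : Bool, Real.exp (l * (sgn b * v i)) := by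
    rw [Fintype.prod_sum]
    simp only [Finset.mul_sum, Real.exp_sum]
  rw [h1]
  calc ∏ i, ∑ b : Bool, Real.exp (l * (sgn b * v i))
      ≤ ∏ i : Fin m, 2 * Real.exp (l ^ 2 / 2) := by
        refine Finset.prod_le_prod (fun i _ => by positivity) fun i _ => ?_
        have h2 := Real.cosh_le_exp_half_sq (l * v i)
        have h3 : Real.exp ((l * v i) ^ 2 / 2) ≤ Real.exp (l ^ 2 / 2) := by
          have : v i ^ 2 ≤ 1 := (sq_le_one_iff_abs_le_one _).2 (hv i)
          apply Real.exp_le_exp.2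
          rw [mul_pow]
          nlinarith [sq_nonneg l]
        rw [Real.cosh_eq] at h2
        simp only [Fintype.sum_bool, sgn, if_true, Bool.false_eq_true, if_false, one_mul,
          neg_mul, mul_neg]
        linarith
    _ = _ := by
        rw [Finset.prod_const, Finset.card_univ, Fintype.card_fin, mul_pow, ← Real.exp_nat_mul]

/-- **Massart's lemma**: the Rademacher average of a maximum over finitely many vectors. -/
theorem sum_sgn_le {m : ℕ} {κ : Type*} (K : Finset κ) (hK : K.Nonempty) (v : κ → Fin m → ℝ)
    (hv : ∀ a i, |v a i| ≤ 1) (F : (Fin m → Bool) → ℝ)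
    (hF : ∀ σ, ∃ a ∈ K, F σ ≤ |∑ i, sgn (σ i) * v a i|) {l : ℝ} (hl : 0 < l) :
    (∑ σ, F σ) / 2 ^ m ≤ Real.log (2 * K.card) / l + m * l / 2 := by
  -- The maximum is replaced by a sum over `K` and both signs, whence the factor `2 * K.card` in the
  -- logarithm.
  have h1 : ∀ σ, Real.exp (l * F σ) ≤ ∑ a ∈ K, (Real.exp (l * ∑ i, sgn (σ i) * v a i) +
      Real.exp (-l * ∑ i, sgn (σ i) * v a i)) := by
    intro σ
    obtain ⟨a, ha, h⟩ := hF σ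
    refine le_trans ?_ (Finset.single_le_sum (f := fun a =>
      Real.exp (l * ∑ i, sgn (σ i) * v a i) + Real.exp (-l * ∑ i, sgn (σ i) * v a i))
      (fun a _ => by positivity) ha)
    have h2 : l * F σ ≤ |l * ∑ i, sgn (σ i) * v a i| := by
      rw [abs_mul, abs_of_pos hl]; gcongr
    refine (Real.exp_le_exp.2 h2).trans ((Real.exp_abs_le _).trans_eq ?_)
    rw [neg_mul]
  have h2 : ∑ σ, Real.exp (l * F σ) ≤ K.card * (2 * (2 ^ m * Real.exp (m * (l ^ 2 / 2)))) := by
    refine (Finset.sum_le_sum fun σ _ => h1 σ).trans ?_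
    rw [Finset.sum_comm]
    refine (Finset.sum_le_card_nsmul _ _ (2 * (2 ^ m * Real.exp (m * (l ^ 2 / 2))))
      fun a _ => ?_).trans_eq (by rw [nsmul_eq_mul])
    rw [Finset.sum_add_distrib, two_mul]
    have h3 := sum_exp_sgn_le (v a) (hv a) (-l)
    rw [neg_sq] at h3
    exact add_le_add (sum_exp_sgn_le (v a) (hv a) l) h3
  have hcard : ∑ σ : Fin m → Bool, ((2 : ℝ) ^ m)⁻¹ = 1 := by simp
  -- Jensen's inequality for the uniform average over signs.
  have h3 : Real.exp (∑ σ, ((2 : ℝ) ^ m)⁻¹ * (l * F σ)) ≤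
      ∑ σ, ((2 : ℝ) ^ m)⁻¹ * Real.exp (l * F σ) :=
    convexOn_exp.map_sum_le (t := Finset.univ) (w := fun _ => ((2 : ℝ) ^ m)⁻¹)
      (p := fun σ => l * F σ) (fun _ _ => by positivity) hcard (fun _ _ => Set.mem_univ _)
  rw [← Finset.mul_sum, ← Finset.mul_sum, ← Finset.mul_sum] at h3
  have hKpos : (0 : ℝ) < 2 * K.card := by
    have : (0 : ℝ) < K.card := by exact_mod_cast hK.card_pos
    positivity
  have h4 : Real.exp (((2 : ℝ) ^ m)⁻¹ * (l * ∑ σ, F σ)) ≤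
      Real.exp (Real.log (2 * K.card) + m * (l ^ 2 / 2)) := by
    rw [Real.exp_add, Real.exp_log hKpos]
    refine h3.trans ((mul_le_mul_of_nonneg_left h2 (by positivity)).trans_eq ?_)
    field_simp
  rw [Real.exp_le_exp] at h4
  rw [← mul_le_mul_iff_right₀ hl]
  refine le_trans (le_of_eq ?_) (h4.trans_eq ?_)
  · ring
  · field_simp

end CPAC

/-! ### Uniform convergence by symmetrization -/

/-- Sample spaces are countable and discrete, so suprema over an arbitrary `H` raise no
measurability issue. -/
theorem MeasureTheory.integrable_of_countable_of_bound {Ω : Type*} [MeasurableSpace Ω]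
    [Countable Ω] [MeasurableSingletonClass Ω] (μ : Measure Ω) [IsFiniteMeasure μ] {f : Ω → ℝ}
    (C : ℝ) (hf : ∀ x, |f x| ≤ C) : Integrable f μ :=
  Integrable.of_bound AEStronglyMeasurable.of_discrete C (Eventually.of_forall hf)

namespace CPAC

/-- The zero-one loss of `h` at a labelled point. -/
def loss (h : ℕ → Bool) (z : ℕ × Bool) : ℝ := if h z.1 ≠ z.2 then 1 else 0

theorem loss_mem_Icc (h : ℕ → Bool) (z : ℕ × Bool) : loss h z ∈ Set.Icc (0 : ℝ) 1 := by
  unfold loss; split_ifs <;> simp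

theorem genError_mem_Icc (D : Measure (ℕ × Bool)) [IsProbabilityMeasure D] (h : ℕ → Bool) :
    genError D h ∈ Set.Icc (0 : ℝ) 1 :=
  ⟨measureReal_nonneg, measureReal_le_one⟩

theorem integral_loss (D : Measure (ℕ × Bool)) (h : ℕ → Bool) :
    ∫ z, loss h z ∂D = genError D h := by
  rw [genError, ← integral_indicator_one (Set.to_countable _).measurableSet]
  refine integral_congr_ae (Eventually.of_forall fun z => ?_)
  simp only [loss, Set.indicator_apply, Set.mem_ofPred_eq, Pi.one_apply]

theorem sampleError_ofFn {m : ℕ} (S : Fin m → ℕ × Bool) (h : ℕ → Bool) :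
    sampleError (List.ofFn S) h = (∑ i, loss h (S i)) / m := by
  rw [sampleError_eq, errorCount_ofFn, List.length_ofFn]
  simp [loss, Finset.sum_ite]

theorem integral_sampleError (D : Measure (ℕ × Bool)) [IsProbabilityMeasure D] {m : ℕ}
    (hm : m ≠ 0) (h : ℕ → Bool) :
    ∫ S, sampleError (List.ofFn S) h ∂(Measure.pi fun _ : Fin m => D) = genError D h := by
  simp only [sampleError_ofFn]
  rw [integral_div, integral_finsetSum]
  · have : ∀ i : Fin m, ∫ S, loss h (S i) ∂(Measure.pi fun _ : Fin m => D) = genError D h := by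
      intro i
      rw [← integral_loss]
      exact integral_comp_eval (μ := fun _ : Fin m => D) AEStronglyMeasurable.of_discrete
    simp only [this, Finset.sum_const, Finset.card_univ, Fintype.card_fin, nsmul_eq_mul]
    field_simp
  · intro i _
    refine integrable_of_countable_of_bound _ 1 fun S => ?_
    rw [abs_of_nonneg (loss_mem_Icc _ _).1]
    exact (loss_mem_Icc _ _).2

/-- The largest deviation, over `H`, of the error on a sample from the generalization error. -/
noncomputable def deviation (H : HypothesisClass) (D : Measure (ℕ × Bool)) {m : ℕ}
    (S : Fin m → ℕ × Bool) : ℝ :=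
  ⨆ h : H, |sampleError (List.ofFn S) h - genError D h|

/-- The largest difference, over `H`, of the errors on two samples. -/
noncomputable def discrepancy (H : HypothesisClass) {m : ℕ} (S S' : Fin m → ℕ × Bool) : ℝ :=
  ⨆ h : H, |sampleError (List.ofFn S) h - sampleError (List.ofFn S') h|

theorem abs_sub_le_one_of_mem_Icc {a b : ℝ} (ha : a ∈ Set.Icc (0 : ℝ) 1)
    (hb : b ∈ Set.Icc (0 : ℝ) 1) : |a - b| ≤ 1 := by
  rw [abs_le]; constructor <;> linarith [ha.1, ha.2, hb.1, hb.2]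

theorem bddAbove_deviation (H : HypothesisClass) (D : Measure (ℕ × Bool))
    [IsProbabilityMeasure D] {m : ℕ} (S : Fin m → ℕ × Bool) :
    BddAbove (Set.range fun h : H => |sampleError (List.ofFn S) h - genError D h|) :=
  ⟨1, by
    rintro _ ⟨h, rfl⟩
    exact abs_sub_le_one_of_mem_Icc (sampleError_mem_Icc _ _) (genError_mem_Icc _ _)⟩

theorem bddAbove_discrepancy (H : HypothesisClass) {m : ℕ} (S S' : Fin m → ℕ × Bool) :
    BddAbove (Set.range fun h : H =>
      |sampleError (List.ofFn S) h - sampleError (List.ofFn S') h|) :=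
  ⟨1, by
    rintro _ ⟨h, rfl⟩
    exact abs_sub_le_one_of_mem_Icc (sampleError_mem_Icc _ _) (sampleError_mem_Icc _ _)⟩

theorem deviation_nonneg (H : HypothesisClass) (D : Measure (ℕ × Bool)) {m : ℕ}
    (S : Fin m → ℕ × Bool) : 0 ≤ deviation H D S :=
  Real.iSup_nonneg fun _ => abs_nonneg _

theorem discrepancy_nonneg (H : HypothesisClass) {m : ℕ} (S S' : Fin m → ℕ × Bool) :
    0 ≤ discrepancy H S S' :=
  Real.iSup_nonneg fun _ => abs_nonneg _

theorem abs_deviation_le (H : HypothesisClass) (D : Measure (ℕ × Bool)) [IsProbabilityMeasure D]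
    {m : ℕ} (S : Fin m → ℕ × Bool) : |deviation H D S| ≤ 1 := by
  rw [abs_of_nonneg (deviation_nonneg H D S)]
  exact Real.iSup_le (fun h => abs_sub_le_one_of_mem_Icc (sampleError_mem_Icc _ _)
    (genError_mem_Icc _ _)) zero_le_one

theorem abs_discrepancy_le (H : HypothesisClass) {m : ℕ} (S S' : Fin m → ℕ × Bool) :
    |discrepancy H S S'| ≤ 1 := by
  rw [abs_of_nonneg (discrepancy_nonneg H S S')]
  exact Real.iSup_le (fun h => abs_sub_le_one_of_mem_Icc (sampleError_mem_Icc _ _)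
    (sampleError_mem_Icc _ _)) zero_le_one

/-- The generalization error is the mean error on an independent ghost sample; absolute value and
supremum then move inside the integral. -/
theorem deviation_le_integral_discrepancy (H : HypothesisClass) (D : Measure (ℕ × Bool))
    [IsProbabilityMeasure D] {m : ℕ} (hm : m ≠ 0) (S : Fin m → ℕ × Bool) :
    deviation H D S ≤ ∫ S', discrepancy H S S' ∂(Measure.pi fun _ : Fin m => D) := by
  refine Real.iSup_le (fun h => ?_) (integral_nonneg fun S' => discrepancy_nonneg H S S')
  have hi : Integrable (fun S' => sampleError (List.ofFn S') h)
      (Measure.pi fun _ : Fin m => D) :=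
    integrable_of_countable_of_bound _ 1 fun S' => by
      rw [abs_of_nonneg (sampleError_mem_Icc _ _).1]; exact (sampleError_mem_Icc _ _).2
  have h1 : sampleError (List.ofFn S) h - genError D h =
      ∫ S', (sampleError (List.ofFn S) h - sampleError (List.ofFn S') h)
        ∂(Measure.pi fun _ : Fin m => D) := by
    rw [integral_sub (integrable_const _) hi, integral_sampleError D hm]
    simp
  rw [h1]
  refine abs_integral_le_integral_abs.trans (integral_mono ?_ ?_ fun S' => ?_)
  · exact integrable_of_countable_of_bound _ 1 fun S' => by
      rw [abs_abs]
      exact abs_sub_le_one_of_mem_Icc (sampleError_mem_Icc _ _) (sampleError_mem_Icc _ _)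
  · exact integrable_of_countable_of_bound _ 1 fun S' => abs_discrepancy_le H S S'
  · exact le_ciSup (bddAbove_discrepancy H S S') h

theorem integral_deviation_le_integral_discrepancy (H : HypothesisClass)
    (D : Measure (ℕ × Bool)) [IsProbabilityMeasure D] {m : ℕ} (hm : m ≠ 0) :
    ∫ S, deviation H D S ∂(Measure.pi fun _ : Fin m => D) ≤
      ∫ w, discrepancy H (fun i => (w i).1) (fun i => (w i).2)
        ∂(Measure.pi fun _ : Fin m => D.prod D) := by
  have hint : Integrable (fun p : (Fin m → ℕ × Bool) × (Fin m → ℕ × Bool) =>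
      discrepancy H p.1 p.2)
      ((Measure.pi fun _ : Fin m => D).prod (Measure.pi fun _ : Fin m => D)) :=
    integrable_of_countable_of_bound _ 1 fun p => abs_discrepancy_le H p.1 p.2
  have h1 := (measurePreserving_arrowProdEquivProdArrow (ℕ × Bool) (ℕ × Bool) (Fin m)
    (fun _ => D) (fun _ => D)).integral_comp' (fun p => discrepancy H p.1 p.2)
  refine le_trans ?_ (le_of_eq h1.symm)
  rw [integral_prod _ hint]
  refine integral_mono ?_ hint.integral_prod_left fun S =>
    deviation_le_integral_discrepancy H D hm S
  exact integrable_of_countable_of_bound _ 1 fun S => abs_deviation_le H D S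

/-- Exchange the two components of `w i` for each `i` with `σ i = false`. -/
def swapAt {m : ℕ} {α : Type*} (σ : Fin m → Bool) (w : Fin m → α × α) : Fin m → α × α :=
  fun i => if σ i then w i else (w i).swap

theorem measurePreserving_swapAt (D : Measure (ℕ × Bool)) [IsProbabilityMeasure D] {m : ℕ}
    (σ : Fin m → Bool) :
    MeasurePreserving (swapAt σ) (Measure.pi fun _ : Fin m => D.prod D)
      (Measure.pi fun _ : Fin m => D.prod D) := by
  refine measurePreserving_pi (f := fun i (p : (ℕ × Bool) × (ℕ × Bool)) => if σ i then p else p.swap) _ _ fun i => ?_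
  cases σ i
  · simpa using Measure.measurePreserving_swap
  · exact MeasurePreserving.id _

/-- A swap only changes the sign of a coordinate's loss difference, and a hypothesis matters only
through its error pattern on the `2 * m` points, so Massart's lemma applies to polynomially many
vectors. -/
theorem sum_discrepancy_swapAt_le {H : HypothesisClass} {d : ℕ} (hd : vcDim H ≤ d)
    (hH : H.Nonempty) {m : ℕ} (hm : m ≠ 0) (w : Fin m → (ℕ × Bool) × (ℕ × Bool)) {l : ℝ}
    (hl : 0 < l) :
    (∑ σ, discrepancy H (fun i => (swapAt σ w i).1) (fun i => (swapAt σ w i).2)) / 2 ^ m ≤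
      Real.log (2 * (2 * m + 1) ^ d) / (l * m) + l / 2 := by
  classical
  have hm0 : (0 : ℝ) < m := by exact_mod_cast Nat.pos_of_ne_zero hm
  have : Nonempty H := hH.to_subtype
  set z : Fin m ⊕ Fin m → ℕ × Bool := Sum.elim (fun i => (w i).1) fun i => (w i).2 with hz
  set v : Finset (Fin m ⊕ Fin m) → Fin m → ℝ := fun P i =>
    (if Sum.inl i ∈ P then 1 else 0) - (if Sum.inr i ∈ P then 1 else 0) with hv
  have hmem : ∀ h : H, errorSet z h ∈ patterns H z := fun h =>
    Finset.mem_filter.2 ⟨Finset.mem_univ _, h, h.2, rfl⟩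
  have hK : (patterns H z).Nonempty := ⟨_, hmem (Classical.arbitrary H)⟩
  have hsum : ∀ (σ : Fin m → Bool) (h : H),
      |sampleError (List.ofFn fun i => (swapAt σ w i).1) h -
        sampleError (List.ofFn fun i => (swapAt σ w i).2) h| =
      |∑ i, sgn (σ i) * v (errorSet z h) i| / m := by
    intro σ h
    rw [sampleError_ofFn, sampleError_ofFn, ← sub_div, ← Finset.sum_sub_distrib, abs_div,
      abs_of_pos hm0]
    congr 2
    refine Finset.sum_congr rfl fun i _ => ?_
    simp only [hv, mem_errorSet, hz, Sum.elim_inl, Sum.elim_inr, loss, swapAt, sgn]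
    by_cases hσ : σ i = true <;> simp [hσ]
  have hF : ∀ σ : Fin m → Bool, ∃ P ∈ patterns H z,
      m * discrepancy H (fun i => (swapAt σ w i).1) (fun i => (swapAt σ w i).2) ≤
        |∑ i, sgn (σ i) * v P i| := by
    intro σ
    obtain ⟨P, hP, hmax⟩ := Finset.exists_max_image (patterns H z)
      (fun P => |∑ i, sgn (σ i) * v P i|) hK
    refine ⟨P, hP, ?_⟩
    rw [← le_div_iff₀' hm0]
    refine ciSup_le fun h => ?_
    rw [hsum]
    exact div_le_div_of_nonneg_right (hmax _ (hmem h)) hm0.le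
  have h1 := sum_sgn_le (patterns H z) hK v (fun P i => by
    simp only [hv]; split_ifs <;> simp) _ hF hl
  rw [← Finset.mul_sum, mul_div_assoc] at h1
  have hcard : ((patterns H z).card : ℝ) ≤ (2 * m + 1) ^ d := by
    have h := card_patterns_le hd z
    simp only [Fintype.card_sum, Fintype.card_fin, ← two_mul] at h
    exact_mod_cast h
  have hlog : Real.log (2 * (patterns H z).card) ≤ Real.log (2 * (2 * m + 1) ^ d) := by
    have : (0 : ℝ) < (patterns H z).card := by exact_mod_cast hK.card_pos
    gcongr
  rw [← mul_le_mul_iff_right₀ hm0]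
  refine h1.trans ?_
  have h2 : (m : ℝ) * (Real.log (2 * (2 * m + 1) ^ d) / (l * m) + l / 2) =
      Real.log (2 * (2 * m + 1) ^ d) / l + m * l / 2 := by
    field_simp
  rw [h2]
  gcongr

/-- Swaps preserve the law of the paired samples, so averaging over all of them is free. -/
theorem integral_deviation_le {H : HypothesisClass} {d : ℕ} (hd : vcDim H ≤ d)
    (hH : H.Nonempty) (D : Measure (ℕ × Bool)) [IsProbabilityMeasure D] {m : ℕ} (hm : m ≠ 0)
    {l : ℝ} (hl : 0 < l) :
    ∫ S, deviation H D S ∂(Measure.pi fun _ : Fin m => D) ≤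
      Real.log (2 * (2 * m + 1) ^ d) / (l * m) + l / 2 := by
  refine (integral_deviation_le_integral_discrepancy H D hm).trans ?_
  set μ := Measure.pi fun _ : Fin m => D.prod D
  set F : (Fin m → (ℕ × Bool) × (ℕ × Bool)) → ℝ := fun w =>
    discrepancy H (fun i => (w i).1) (fun i => (w i).2) with hF
  have hint : ∀ σ : Fin m → Bool, Integrable (fun w => F (swapAt σ w)) μ := fun σ =>
    integrable_of_countable_of_bound _ 1 fun w => abs_discrepancy_le H _ _
  have hswap : ∀ σ : Fin m → Bool, ∫ w, F (swapAt σ w) ∂μ = ∫ w, F w ∂μ := by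
    intro σ
    have h := measurePreserving_swapAt D σ
    rw [← integral_map (f := F) h.measurable.aemeasurable AEStronglyMeasurable.of_discrete, h.map_eq]
  have h1 : ∫ w, F w ∂μ = ∫ w, (∑ σ : Fin m → Bool, F (swapAt σ w)) / 2 ^ m ∂μ := by
    rw [integral_div, integral_finsetSum _ fun σ _ => hint σ]
    simp [hswap]
  rw [h1]
  refine (integral_mono ((integrable_finsetSum _ fun σ _ => hint σ).div_const _)
    (integrable_const _) fun w => sum_discrepancy_swapAt_le hd hH hm w hl).trans_eq ?_
  simp

theorem tendsto_log_growth (d : ℕ) :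
    Tendsto (fun m : ℕ => Real.log (2 * (2 * m + 1) ^ d) / m) atTop (𝓝 0) := by
  have h1 : Tendsto (fun m : ℕ => Real.log (2 * m + 1) / m) atTop (𝓝 0) := by
    -- The coefficients express `m` as `(2m+1)/2 - 1/2`.
    have h := Real.tendsto_pow_log_div_mul_add_atTop (1 / 2) (-(1 / 2)) 1 (by norm_num)
    have h2 : Tendsto (fun m : ℕ => (2 * m + 1 : ℝ)) atTop atTop :=
      tendsto_atTop_add_const_right _ _
        (tendsto_natCast_atTop_atTop.const_mul_atTop (by norm_num))
    refine (h.comp h2).congr fun m => ?_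
    simp only [Function.comp_apply, pow_one]
    congr 1; ring
  have h2 : Tendsto (fun m : ℕ => Real.log 2 / (m : ℝ)) atTop (𝓝 0) :=
    tendsto_const_nhds.div_atTop tendsto_natCast_atTop_atTop
  have h3 := h2.add (h1.const_mul (d : ℝ))
  simp only [mul_zero, add_zero] at h3
  refine h3.congr fun m => ?_
  rw [Real.log_mul (by norm_num) (by positivity), Real.log_pow]
  ring

/-- **Uniform convergence** for classes of finite VC dimension, in expectation. -/
theorem exists_integral_deviation_le {H : HypothesisClass} (hd : vcDim H < ⊤)
    (hH : H.Nonempty) {δ : ℝ} (hδ : 0 < δ) :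
    ∃ M : ℕ, ∀ m ≥ M, ∀ D : Measure (ℕ × Bool), IsProbabilityMeasure D →
      ∫ S, deviation H D S ∂(Measure.pi fun _ : Fin m => D) ≤ δ := by
  obtain ⟨d, hd'⟩ := ENat.ne_top_iff_exists.1 hd.ne
  -- With `l = δ`, each of the two terms of the bound is at most `δ/2`.
  obtain ⟨M, hM⟩ := eventually_atTop.1
    ((tendsto_log_growth d).eventually_le_const (u := δ * (δ / 2)) (by positivity))
  refine ⟨M + 1, fun m hm D _ => ?_⟩
  refine (integral_deviation_le hd'.ge hH D (by omega) hδ).trans ?_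
  have h1 := hM m (by omega)
  have h2 : Real.log (2 * (2 * m + 1) ^ d) / (δ * m) =
      Real.log (2 * (2 * m + 1) ^ d) / m / δ := by
    rw [div_div, mul_comm δ]
  have h3 : Real.log (2 * (2 * m + 1) ^ d) / m / δ ≤ δ / 2 := by
    rwa [div_le_iff₀' hδ]
  rw [h2]; linarith

/-! ### From uniform convergence back to PAC learning -/

/-- The deviation is paid twice: at the output and at the competitor. -/
theorem genError_le_of_deviation_le {A : Learner} {H : HypothesisClass} (hp : IsProper A H)
    (D : Measure (ℕ × Bool)) [IsProbabilityMeasure D] {m : ℕ} (S : Fin m → ℕ × Bool) {η ε : ℝ}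
    (hS : deviation H D S ≤ η)
    (hε : sampleError (List.ofFn S) (A (List.ofFn S)) ≤
      (⨅ h : H, sampleError (List.ofFn S) h) + ε) :
    genError D (A (List.ofFn S)) ≤ (⨅ h : H, genError D h) + (2 * η + ε) := by
  have : Nonempty H := ⟨⟨A [], hp _⟩⟩
  have hdev : ∀ h : H, |sampleError (List.ofFn S) h - genError D h| ≤ η := fun h =>
    (le_ciSup (bddAbove_deviation H D S) h).trans hS
  rw [← sub_le_iff_le_add]
  refine le_ciInf fun h => ?_
  have h1 := abs_le.1 (hdev ⟨_, hp (List.ofFn S)⟩)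
  have h2 := abs_le.1 (hdev h)
  have h3 := ciInf_le (bddBelow_sampleError (List.ofFn S) H) h
  simp only at h1 h3
  linarith [h1.1, h2.2]

theorem IsAsymptoticERM.pacLearns {A : Learner} {H : HypothesisClass} (hd : vcDim H < ⊤)
    (hA : IsAsymptoticERM A H) : PACLearns A H := by
  obtain ⟨hp, ε, -, hε, hA⟩ := hA
  intro n hn
  have hn0 : (0 : ℝ) < n := by exact_mod_cast hn
  -- The error budget is `2 * η + 1/(2n) = 1/n`; an expected deviation of at most `η/n` makes
  -- Markov's failure probability at most `1/n`.
  set η : ℝ := 1 / (4 * n) with hη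
  have hη0 : 0 < η := by positivity
  obtain ⟨M₁, hM₁⟩ := exists_integral_deviation_le hd ⟨A [], hp _⟩
    (mul_pos hη0 (one_div_pos.2 hn0))
  obtain ⟨M₂, hM₂⟩ := eventually_atTop.1
    (hε.eventually_le_const (show (0 : ℝ) < 1 / (2 * n) by positivity))
  refine ⟨M₁ + M₂ + 1, fun m hm D _ => ?_⟩
  set μ := Measure.pi fun _ : Fin m => D
  have h1 := mul_meas_ge_le_integral_of_nonneg (μ := μ) (f := deviation H D)
    (Eventually.of_forall fun S => deviation_nonneg H D S)
    (integrable_of_countable_of_bound _ 1 fun S => abs_deviation_le H D S) η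
  have h2 : μ.real {S | η ≤ deviation H D S} ≤ 1 / n :=
    le_of_mul_le_mul_left (h1.trans (hM₁ m (by omega) D inferInstance)) hη0
  have h3 : μ.real {S | η ≤ deviation H D S}ᶜ = 1 - μ.real {S | η ≤ deviation H D S} :=
    probReal_compl_eq_one_sub (Set.to_countable _).measurableSet
  refine le_trans (by rw [h3]; linarith) (measureReal_mono (fun S hS => ?_))
  have hS' : deviation H D S ≤ η := (not_le.1 (show ¬ η ≤ deviation H D S from hS)).le
  have hne : List.ofFn S ≠ [] := by
    intro h
    have := congrArg List.length h
    simp at this; omega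
  have h4 := genError_le_of_deviation_le hp D S hS' (hA _ hne)
  refine h4.trans ?_
  rw [List.length_ofFn]
  have h5 := hM₂ m (by omega)
  have h6 : 2 * η + 1 / (2 * n) = 1 / n := by rw [hη]; field_simp; norm_num
  linarith

end CPAC

theorem proposition3p7 (H : CPAC.HypothesisClass) :
    CPAC.ProperlyCPACLearnable H ↔
      CPAC.vcDim H < ⊤ ∧
        ∃ A : CPAC.Learner, CPAC.IsComputableLearner A ∧ CPAC.IsAsymptoticERM A H := by
  constructor
  · rintro ⟨A, hc, hp, hA⟩
    exact ⟨hA.vcDim_lt_top, _, hc.bestWord, hA.isAsymptoticERM_bestWord hp⟩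
  · rintro ⟨hd, A, hc, hA⟩
    exact ⟨A, hc, hA.1, hA.pacLearns hd⟩
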